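/- Let $K$ be a field of characteristic $0$, and let $\mathrm{NSym}=K\langle\Lambda_1,\Lambda_2,\dots\rangle$ be the free associative algebra on generators $\Lambda_k$ ($k\ge 1$), with $\Lambda_0=1$. Define $S_k\in\mathrm{NSym}$ by $\sum_{k\ge0}S_kt^k=\bigl(\sum_{k\ge0}\Lambda_k(-t)^k\bigr)^{-1}$. For a composition $I=i_1\cdots i_s\vDash n$ (a sequence of positive integers with sum $n$) put $S^I=S_{i_1}\cdots S_{i_s}$ and $\varepsilon^I=(-1)^{n-s}$, and define the ribbon Schur function $R_I$ by \[ \varepsilon^I R_I=\sum_{J\preceq I}\varepsilon^J S^J, \] where $J\preceq I$ means that $I$ is a refinement of $J$. Let $\rho$ be the $K$-algebra homomorphism from $\mathrm{NSym}$ to the symmetric functions over $K$ (in $x_1,x_2,\dots$) with $\rho(\Lambda_k)=e_k$, the $k$-th elementary symmetric function. An element $F\in\mathrm{NSym}$ is a noncommutative analog of a symmetric function $f$ if $\rho(F)=f$. For a finite graph $G$ with vertex set $V$, the chromatic symmetric function is $X_G=\sum_\kappa\prod_{v\in V}x_{\kappa(v)}$, where $\kappa$ runs over the proper colorings $\kappa\colon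 V\to\{1,2,\dots\}$ of $G$. Let $n\ge2$ and let $C_n$ be the cycle on $n$ vertices (for $n=2$, two adjacent vertices). Then $X_{C_n}$ has the noncommutative analog \[ \widetilde X_{C_n} =\sum_{\substack{I=i_1\cdots i_s\vDash n\\ i_1=i_s=1,\ i_2,\dots,i_{s-1}\le2}} 2^{m_1(I)}\Bigl(1-\frac1{2^{r}}\Bigr)R_I-R_{1^n}, \] where $m_1(I)$ is the number of parts of $I$ equal to $1$, $r=r(I)$ is the largest number such that the first $r$ parts of $I$ are all equal to $1$, and $1^n$ is the composition of $n$ with $n$ parts equal to $1$. Moreover, $\widetilde X_{C_n}$ is ribbon-positive, that is, a linear combination of the $R_I$, $I\vDash n$, with nonnegative rational coefficients. -/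

import Mathlib

noncomputable section

/-- The algebra of noncommutative symmetric functions over `K`: the free associative algebra
on generators `Λ_1, Λ_2, …`. -/
abbrev NSym (K : Type*) [Field K] : Type _ := FreeAlgebra K ℕ+

namespace NSym

variable (K : Type*) [Field K]

/-- The noncommutative elementary symmetric functions `Λ_k`, with `Λ_0 = 1`. -/
def elem : ℕ → NSym K
  | 0 => 1
  | k + 1 => FreeAlgebra.ι K k.succPNat

/-- The power series `λ(-t) = ∑ (-1)^k Λ_k t^k`. -/
def elemSeriesNeg : PowerSeries (NSym K) :=
  PowerSeries.mk fun k => (-1) ^ k * elem K k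

/-- The noncommutative complete homogeneous symmetric functions `S_k`, given by
`∑ S_k t^k = 1 / λ(-t)`. -/
def complete (k : ℕ) : NSym K :=
  PowerSeries.coeff k (PowerSeries.invOfUnit (elemSeriesNeg K) 1)

/-- `S^I = S_{i_1} S_{i_2} ⋯` for a composition `I = i_1 i_2 ⋯`. -/
def completeProd {n : ℕ} (I : Composition n) : NSym K :=
  (I.blocks.map (complete K)).prod

end NSym

/-- The reverse refinement order `J ⪯ I`: the composition `I` is a refinement of `J`, i.e. each
partial sum of `J` is a partial sum of `I`. -/
def Composition.IsCoarsening {n : ℕ} (J I : Composition n) : Prop :=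
  J.boundaries ⊆ I.boundaries

/-- The sign `ε^I = (-1)^(|I| - ℓ(I))` (note `ℓ(I) ≤ |I|`). -/
def Composition.sgn {n : ℕ} (I : Composition n) : ℤ :=
  (-1) ^ (n - I.length)

namespace NSym

open Classical in
/-- The ribbon Schur function `R_I`, determined by `ε^I R_I = ∑_{J ⪯ I} ε^J S^J`. -/
def ribbon (K : Type*) [Field K] {n : ℕ} (I : Composition n) : NSym K :=
  I.sgn • ∑ J : Composition n with J.IsCoarsening I, J.sgn • completeProd K J

/-- `F` is ribbon-positive of degree `n`: a linear combination of the `R_I`, for `I` a composition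
of `n`, with nonnegative rational coefficients. -/
def RibbonPositive {K : Type*} [Field K] (n : ℕ) (F : NSym K) : Prop :=
  ∃ c : Composition n → ℚ, (∀ I, 0 ≤ c I) ∧ F = ∑ I, (c I : K) • ribbon K I

end NSym

/-- The formal power series `∑_{a : α} x^(w a)` in `x_0, x_1, …`, for a family of monomials in
which each monomial occurs finitely often: the coefficient of `x^d` is the number of `a` with
`w a = d`. -/
def monomialSum (K : Type*) [Field K] {α : Type*} (w : α → ℕ →₀ ℕ) : MvPowerSeries ℕ K :=
  fun d => (Nat.card {a : α // w a = d} : K)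

/-- The elementary symmetric function `e_k`, the sum of `∏_{i ∈ s} x_i` over the `k`-element sets
`s` of indices. -/
def elemSymm (K : Type*) [Field K] (k : ℕ) : MvPowerSeries ℕ K :=
  monomialSum K fun s : {s : Finset ℕ // s.card = k} => ∑ i ∈ s.1, Finsupp.single i 1

/-- The chromatic symmetric function `X_G`, the sum of `∏_v x_{κ(v)}` over the proper colorings
`κ` of `G`. -/
def chromaticSymm (K : Type*) [Field K] {V : Type*} [Fintype V] (G : SimpleGraph V) :
    MvPowerSeries ℕ K :=
  monomialSum K fun κ : G.Coloring ℕ => ∑ v, Finsupp.single (κ v) 1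

namespace NSym

/-- The projection `ρ`, the algebra map with `ρ(Λ_k) = e_k`; equivalently the linear map with
`ρ(Λ^I) = e_I`. Symmetric functions are regarded as formal power series. -/
def commImage (K : Type*) [Field K] : NSym K →ₐ[K] MvPowerSeries ℕ K :=
  FreeAlgebra.lift K fun k : ℕ+ => elemSymm K k

/-- `F` is a noncommutative analog of `f`: `f` is the commutative image of `F`. -/
def IsAnalog {K : Type*} [Field K] (F : NSym K) (f : MvPowerSeries ℕ K) : Prop :=
  commImage K F = f

end NSym

namespace Composition

/-- The number `m_1(I)` of parts of `I` equal to `1`. -/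
def numOnes {n : ℕ} (I : Composition n) : ℕ :=
  I.blocks.count 1

/-- The number `r` of parts `1` that start `I`. -/
def leadingOnes {n : ℕ} (I : Composition n) : ℕ :=
  (I.blocks.takeWhile (· = 1)).length

/-- The first and last parts of `I` are `1` and all the parts strictly between are at most `2`. -/
def IsCycleIndex {n : ℕ} (I : Composition n) : Prop :=
  I.blocks.head? = some 1 ∧ I.blocks.getLast? = some 1 ∧ ∀ i ∈ I.blocks.tail.dropLast, i ≤ 2

end Composition

end

noncomputable section

open Finset

/-! Commutative side. Let θ = t d/dt, E = Σ e_k t^k, P = Σ_{k≥1} (-1)^(k-1) p_k t^k, and let A and C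
be the generating functions of paths and cycles. Newton's identities say θE = PE. Attaching a vertex
of weight k to the front of a coloured path either gives a longer proper path or repeats the first
colour, in which case the two vertices merge; unrolling this gives A = 1 + PA. Comparing the two
ends of a path in the same way gives C = (θP)A - P. Elimination yields C(E - θE) = θ²E - θE
(`cycleSeries_mul`), that is, C = (Σ k(k-1) e_k t^k)(1 - Σ (k-1) e_k t^k)⁻¹. Replacing e_k by Λ_k,
with the inverse on the right, gives a noncommutative analog.

Ribbon side. Here Λ_k = R_{1^k} (`elem_eq_ribbonList`), and a product of two ribbons is the
concatenation plus the near-concatenation (`ribbonList_append_mul`). Let T(j,m) = Σ 2^{m_1(l)}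
R_{1^j l} over lists l of 1s and 2s with sum m and last entry 1. The product rule turns Λ_{k+1}
T(1,m) into a second difference of T along j + m constant (`elem_mul_tailSum`). Summation by parts
against the weight k shows that T(1,n)/2 is the coefficient of t^(n+1) in the inverse series.
Against k(k+1) it evaluates the whole quotient as Σ_j T(j+1, n-j). In that sum a ribbon with r
leading ones collects 2^{m_1-1} + ... + 2^{m_1-r} = 2^{m_1}(1 - 2^{-r}); only 1^(n+1) falls short,
by one, because l cannot be empty. This is the subtracted term. -/

/-- The formal power series `∑_{a ∈ s} x^(w a)`. -/
def monomialSumOn (K : Type*) [Field K] {α : Type*} (s : Set α) (w : α → ℕ →₀ ℕ) :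
    MvPowerSeries ℕ K :=
  fun d => ({a | a ∈ s ∧ w a = d}.ncard : K)

/-! ### Generating functions of weighted families -/

section MonomialSum

variable {K : Type*} [Field K] {α β γ : Type*}

theorem coeff_monomialSumOn (s : Set α) (w : α → ℕ →₀ ℕ) (d : ℕ →₀ ℕ) :
    MvPowerSeries.coeff d (monomialSumOn K s w) = ({a | a ∈ s ∧ w a = d}.ncard : K) := rfl

theorem monomialSumOn_empty (w : α → ℕ →₀ ℕ) : monomialSumOn K ∅ w = 0 := by
  ext d
  simp [coeff_monomialSumOn]

theorem monomialSumOn_singleton (a : α) (w : α → ℕ →₀ ℕ) (h : w a = 0) :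
    monomialSumOn K {a} w = 1 := by
  ext d
  rw [coeff_monomialSumOn, MvPowerSeries.coeff_one]
  split_ifs with hd
  · have : {b | b ∈ ({a} : Set α) ∧ w b = d} = {a} := by
      ext b
      simp only [Set.mem_singleton_iff, Set.mem_ofPred_eq, and_iff_left_iff_imp]
      rintro rfl
      rw [h, hd]
    rw [this, Set.ncard_singleton, Nat.cast_one]
  · have : {b | b ∈ ({a} : Set α) ∧ w b = d} = ∅ := by
      ext b
      simp only [Set.mem_singleton_iff, Set.mem_ofPred_eq, Set.mem_empty_iff_false, iff_false]
      rintro ⟨rfl, hb⟩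
      exact hd (hb.symm.trans h)
    rw [this, Set.ncard_empty, Nat.cast_zero]

/-- Finiteness of the fibres is essential: `ncard` is 0 on infinite sets, so additivity would fail
without it. -/
theorem monomialSumOn_union {s t : Set α} {w : α → ℕ →₀ ℕ} (hw : ∀ d, {a | w a = d}.Finite)
    (hst : Disjoint s t) :
    monomialSumOn K (s ∪ t) w = monomialSumOn K s w + monomialSumOn K t w := by
  ext d
  rw [map_add, coeff_monomialSumOn, coeff_monomialSumOn, coeff_monomialSumOn, ← Nat.cast_add,
    ← Set.ncard_union_eq ?_ ((hw d).subset fun a h => h.2) ((hw d).subset fun a h => h.2)]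
  · congr 2
    ext a
    simp only [Set.mem_union, Set.mem_ofPred_eq]
    tauto
  · rw [Set.disjoint_left] at hst ⊢
    exact fun a h1 h2 => hst h1.1 h2.1

theorem monomialSumOn_image {s : Set α} {w : α → ℕ →₀ ℕ} {w' : β → ℕ →₀ ℕ} (f : α → β)
    (hf : Set.InjOn f s) (hw : ∀ a ∈ s, w' (f a) = w a) :
    monomialSumOn K (f '' s) w' = monomialSumOn K s w := by
  ext d
  rw [coeff_monomialSumOn, coeff_monomialSumOn]
  have : {b | b ∈ f '' s ∧ w' b = d} = f '' {a | a ∈ s ∧ w a = d} := by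
    ext b
    constructor
    · rintro ⟨⟨a, ha, rfl⟩, h⟩
      exact ⟨a, ⟨ha, (hw a ha).symm.trans h⟩, rfl⟩
    · rintro ⟨a, ⟨ha, h⟩, rfl⟩
      exact ⟨⟨a, ha, rfl⟩, (hw a ha).trans h⟩
  rw [this, Set.InjOn.ncard_image (hf.mono fun a h => h.1)]

theorem monomialSum_eq_monomialSumOn (f : α → β) (hf : Function.Injective f)
    (w : β → ℕ →₀ ℕ) :
    monomialSum K (fun a => w (f a)) = monomialSumOn K (Set.range f) w := by
  rw [← Set.image_univ, monomialSumOn_image (w := fun a => w (f a)) f hf.injOn fun _ _ => rfl]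
  ext d
  rw [coeff_monomialSumOn]
  simp only [Set.mem_univ, true_and]
  rfl

theorem monomialSumOn_mul {s : Set α} {t : Set β} {w : α → ℕ →₀ ℕ} {w' : β → ℕ →₀ ℕ}
    (hw : ∀ d, {a | w a = d}.Finite) (hw' : ∀ d, {b | w' b = d}.Finite) :
    monomialSumOn K s w * monomialSumOn K t w' =
      monomialSumOn K (s ×ˢ t) (fun p => w p.1 + w' p.2) := by
  classical
  ext d
  rw [MvPowerSeries.coeff_mul, coeff_monomialSumOn]
  have hfin : ∀ p : (ℕ →₀ ℕ) × (ℕ →₀ ℕ),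
      ({a | a ∈ s ∧ w a = p.1} ×ˢ {b | b ∈ t ∧ w' b = p.2}).Finite := fun p =>
    ((hw p.1).subset fun a h => h.2).prod ((hw' p.2).subset fun a h => h.2)
  have key : {q : α × β | q ∈ s ×ˢ t ∧ w q.1 + w' q.2 = d} =
      ↑((antidiagonal d).biUnion fun p => (hfin p).toFinset) := by
    ext q
    simp only [Set.mem_ofPred_eq, Set.mem_prod, coe_biUnion, Set.Finite.coe_toFinset,
      Set.mem_iUnion, mem_coe, HasAntidiagonal.mem_antidiagonal, exists_prop, Prod.exists]
    constructor
    · rintro ⟨⟨h1, h2⟩, h⟩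
      exact ⟨_, _, h, ⟨h1, rfl⟩, h2, rfl⟩
    · rintro ⟨a, b, h, ⟨h1, rfl⟩, h2, rfl⟩
      exact ⟨⟨h1, h2⟩, h⟩
  rw [key, Set.ncard_coe_finset, card_biUnion, Nat.cast_sum]
  · refine sum_congr rfl fun p _ => ?_
    rw [coeff_monomialSumOn, coeff_monomialSumOn, ← Set.ncard_eq_toFinset_card _ (hfin p), Set.ncard_prod,
      Nat.cast_mul]
  · intro p _ p' _ hne
    refine Finset.disjoint_left.2 fun q h1 h2 => ?_
    simp only [Set.Finite.mem_toFinset, Set.mem_prod, Set.mem_ofPred_eq] at h1 h2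
    exact hne (Prod.ext (h1.1.2.symm.trans h2.1.2) (h1.2.2.symm.trans h2.2.2))

end MonomialSum

/-! ### Weights of words and of finite sets -/

/-- The exponent of the monomial of a word. -/
def wordWeight (l : List ℕ) : ℕ →₀ ℕ := (l.map fun i => Finsupp.single i 1).sum

@[simp] theorem wordWeight_nil : wordWeight [] = 0 := rfl

@[simp] theorem wordWeight_cons (i : ℕ) (l : List ℕ) :
    wordWeight (i :: l) = Finsupp.single i 1 + wordWeight l := by
  simp [wordWeight]

@[simp] theorem wordWeight_append (l l' : List ℕ) :
    wordWeight (l ++ l') = wordWeight l + wordWeight l' := by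
  simp [wordWeight]

theorem wordWeight_eq_toFinsupp (l : List ℕ) : wordWeight l = Multiset.toFinsupp (l : Multiset ℕ) := by
  induction l with
  | nil => simp
  | cons i l ih => rw [wordWeight_cons, ih, ← Multiset.cons_coe, ← Multiset.singleton_add, map_add,
      Multiset.toFinsupp_singleton]

theorem finite_wordWeight_eq (d : ℕ →₀ ℕ) : {l | wordWeight l = d}.Finite := by
  refine (Multiset.finite_toSet (Multiset.lists (Multiset.toFinsupp.symm d))).subset fun l hl => ?_
  have hl : wordWeight l = d := hl
  rw [Set.mem_ofPred_eq, Multiset.mem_lists_iff, ← hl, wordWeight_eq_toFinsupp]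
  simp

/-- The exponent of the monomial of a finite set. -/
def setWeight (s : Finset ℕ) : ℕ →₀ ℕ := ∑ i ∈ s, Finsupp.single i 1

theorem setWeight_injective : Function.Injective setWeight := by
  intro s t h
  ext i
  have h := DFunLike.congr_fun h i
  simp only [setWeight, Finsupp.coe_finsetSum, Finset.sum_apply, Finsupp.single_apply,
    Finset.sum_ite_eq'] at h
  by_cases h1 : i ∈ s <;> by_cases h2 : i ∈ t <;> simp_all

theorem finite_setWeight_eq (d : ℕ →₀ ℕ) : {s | setWeight s = d}.Finite :=
  Set.Subsingleton.finite fun _ hs _ ht => setWeight_injective (hs.trans ht.symm)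

theorem finite_single_eq (k : ℕ) (d : ℕ →₀ ℕ) :
    {i | Finsupp.single i (k + 1) = d}.Finite :=
  Set.Subsingleton.finite fun _ hs _ ht =>
    Finsupp.single_left_injective (Nat.succ_ne_zero k) (hs.trans ht.symm)

theorem finite_add_eq {α β : Type*} {w : α → ℕ →₀ ℕ} {w' : β → ℕ →₀ ℕ}
    (hw : ∀ d, {a | w a = d}.Finite) (hw' : ∀ d, {b | w' b = d}.Finite) (d : ℕ →₀ ℕ) :
    {p : α × β | w p.1 + w' p.2 = d}.Finite := by
  classical
  have : (⋃ p ∈ antidiagonal d, ({a | w a = p.1} ×ˢ {b | w' b = p.2} : Set (α × β))).Finite :=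
    (antidiagonal d).finite_toSet.biUnion fun p _ => (hw p.1).prod (hw' p.2)
  refine this.subset fun p hp => ?_
  simp only [Set.mem_iUnion]
  exact ⟨(w p.1, w' p.2), HasAntidiagonal.mem_antidiagonal.2 hp, rfl, rfl⟩

/-! ### Recurrences for paths, cycles and elementary symmetric functions -/

section Series

variable (K : Type*) [Field K]

/-- The power sum `p_(k+1)`. -/
def powerSumSucc (k : ℕ) : MvPowerSeries ℕ K :=
  monomialSumOn K Set.univ fun i => Finsupp.single i (k + 1)

/-- The chromatic symmetric function of the path with `n` vertices, as a sum over words. -/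
def pathSum (n : ℕ) : MvPowerSeries ℕ K :=
  monomialSumOn K {l | l.length = n ∧ l.IsChain (· ≠ ·)} wordWeight

/-- Colorings of the path with `n` vertices in which the first vertex has weight `k + 1`. -/
def weightedPathSum : ℕ → ℕ → MvPowerSeries ℕ K
  | 0, _ => 0
  | n + 1, k => monomialSumOn K {p : ℕ × List ℕ | p.2.length = n ∧ (p.1 :: p.2).IsChain (· ≠ ·)}
      fun p => Finsupp.single p.1 (k + 1) + wordWeight p.2

/-- Colorings of the cycle with `n + 1` vertices in which the first vertex has weight `k + 1`. -/
def weightedCycleSum (n k : ℕ) : MvPowerSeries ℕ K :=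
  monomialSumOn K
    {p : ℕ × List ℕ | p.2.length = n ∧ (p.1 :: (p.2 ++ [p.1])).IsChain (· ≠ ·)}
    fun p => Finsupp.single p.1 (k + 1) + wordWeight p.2

/-- The sum over sets with `m` elements of which one has weight `k + 1`. -/
def weightedSetSum : ℕ → ℕ → MvPowerSeries ℕ K
  | 0, _ => 0
  | m + 1, k => monomialSumOn K {p : ℕ × Finset ℕ | p.2.card = m ∧ p.1 ∉ p.2}
      fun p => Finsupp.single p.1 (k + 1) + setWeight p.2

theorem elemSymm_eq (k : ℕ) :
    elemSymm K k = monomialSumOn K {s : Finset ℕ | s.card = k} setWeight := by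
  have := monomialSum_eq_monomialSumOn (K := K) (Subtype.val : {s : Finset ℕ // s.card = k} → _)
    Subtype.val_injective setWeight
  rw [Subtype.range_coe_subtype] at this
  exact this

theorem elemSymm_zero : elemSymm K 0 = 1 := by
  rw [elemSymm_eq]
  have : {s : Finset ℕ | s.card = 0} = {∅} := by ext; simp
  rw [this, monomialSumOn_singleton _ _ (by simp [setWeight])]

theorem pathSum_zero : pathSum K 0 = 1 := by
  have : {l : List ℕ | l.length = 0 ∧ l.IsChain (· ≠ ·)} = {[]} := by
    ext l
    simp only [List.length_eq_zero_iff, Set.mem_ofPred_eq, Set.mem_singleton_iff,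
      and_iff_left_iff_imp]
    rintro rfl
    simp
  rw [pathSum, this, monomialSumOn_singleton _ _ (by simp)]

theorem pathSum_succ (n : ℕ) : pathSum K (n + 1) = weightedPathSum K (n + 1) 0 := by
  rw [pathSum, weightedPathSum, ← monomialSumOn_image (w' := wordWeight)
    (fun p : ℕ × List ℕ => p.1 :: p.2)]
  · congr 1
    ext l
    constructor
    · rintro ⟨h1, h2⟩
      match l with
      | i :: l => exact ⟨(i, l), ⟨by simpa using h1, h2⟩, rfl⟩
    · rintro ⟨⟨i, l⟩, ⟨h1, h2⟩, rfl⟩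
      exact ⟨by simpa using h1, h2⟩
  · rintro ⟨i, l⟩ _ ⟨j, l'⟩ _ h
    simpa using h
  · simp

/-- The new vertex of weight k + 1 either differs in colour from the first vertex of the path, or
agrees with it and absorbs its weight. An empty path leaves nothing to absorb, whence the value 0 of
`weightedPathSum` at no vertices. -/
theorem powerSumSucc_mul_pathSum (n k : ℕ) :
    powerSumSucc K k * pathSum K n =
      weightedPathSum K (n + 1) k + weightedPathSum K n (k + 1) := by
  have hfin := finite_add_eq (finite_single_eq k) finite_wordWeight_eq
  rw [powerSumSucc, pathSum, monomialSumOn_mul (finite_single_eq k) finite_wordWeight_eq]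
  cases n with
  | zero =>
    rw [weightedPathSum, weightedPathSum, add_zero]
    congr 1
    ext ⟨i, l⟩
    simp only [List.length_eq_zero_iff, Set.mem_prod, Set.mem_univ, Set.mem_ofPred_eq, true_and]
    constructor
    · rintro ⟨rfl, _⟩; simp
    · rintro ⟨rfl, _⟩; simp
  | succ n =>
    rw [weightedPathSum, weightedPathSum, ← monomialSumOn_image
      (w := fun p : ℕ × List ℕ => Finsupp.single p.1 (k + 1 + 1) + wordWeight p.2)
      (w' := fun p : ℕ × List ℕ => Finsupp.single p.1 (k + 1) + wordWeight p.2)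
      (fun p : ℕ × List ℕ => (p.1, p.1 :: p.2)), ← monomialSumOn_union hfin]
    · congr 1
      ext ⟨i, l⟩
      constructor
      · rintro ⟨-, h1, h2⟩
        match l with
        | j :: l =>
          by_cases hij : i = j
          · subst hij
            exact Or.inr ⟨(i, l), ⟨by simpa using h1, h2⟩, rfl⟩
          · exact Or.inl ⟨h1, List.isChain_cons_cons.2 ⟨hij, h2⟩⟩
      · rintro (⟨h1, h2⟩ | ⟨⟨j, l'⟩, ⟨h1, h2⟩, h⟩)
        · exact ⟨trivial, h1, (List.isChain_cons.1 h2).2⟩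
        · obtain ⟨rfl, rfl⟩ := Prod.mk.inj h
          exact ⟨trivial, by simpa using h1, h2⟩
    · rw [Set.disjoint_left]
      rintro ⟨i, l⟩ ⟨h1, h2⟩ ⟨⟨j, l'⟩, -, h⟩
      obtain ⟨rfl, rfl⟩ := Prod.mk.inj h
      simp at h2
    · rintro ⟨i, l⟩ _ ⟨j, l'⟩ _ h
      simp at h
      simp [h]
    · rintro ⟨i, l⟩ _
      simp only [wordWeight_cons, ← add_assoc, ← Finsupp.single_add]

/-- A cycle with one vertex is a loop, which has no proper colouring. -/
theorem weightedCycleSum_zero (k : ℕ) : weightedCycleSum K 0 k = 0 := by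
  rw [weightedCycleSum, ← monomialSumOn_empty (K := K)]
  congr 1
  ext ⟨i, l⟩
  simp only [List.length_eq_zero_iff, Set.mem_ofPred_eq, Set.mem_empty_iff_false, iff_false]
  rintro ⟨rfl, h⟩
  simp at h

/-- Close up the path: if its ends have different colours it is a coloured cycle, and otherwise the
last vertex merges into the first. -/
theorem weightedPathSum_eq_add (n k : ℕ) :
    weightedPathSum K (n + 2) k =
      weightedCycleSum K (n + 1) k + weightedCycleSum K n (k + 1) := by
  have hfin := finite_add_eq (finite_single_eq k) finite_wordWeight_eq
  rw [weightedPathSum, weightedCycleSum, weightedCycleSum, ← monomialSumOn_image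
      (w := fun p : ℕ × List ℕ => Finsupp.single p.1 (k + 1 + 1) + wordWeight p.2)
      (w' := fun p : ℕ × List ℕ => Finsupp.single p.1 (k + 1) + wordWeight p.2)
      (fun p : ℕ × List ℕ => (p.1, p.2 ++ [p.1])), ← monomialSumOn_union hfin]
  · congr 1
    ext ⟨i, l⟩
    constructor
    · rintro ⟨h1, h2⟩
      rcases List.eq_nil_or_concat l with rfl | ⟨l, j, rfl⟩
      · simp at h1
      · simp only [List.concat_eq_append, List.length_append, List.length_cons, List.length_nil,
          zero_add, Nat.add_right_cancel_iff] at h1 h2 ⊢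
        by_cases hij : j = i
        · subst hij
          exact Or.inr ⟨(j, l), ⟨h1, h2⟩, rfl⟩
        · refine Or.inl ⟨by simpa using h1, ?_⟩
          rw [← List.cons_append, List.isChain_append]
          refine ⟨h2, by simp, ?_⟩
          rw [← List.cons_append, List.getLast?_concat]
          simpa using hij
    · rintro (⟨h1, h2⟩ | ⟨⟨j, l'⟩, ⟨h1, h2⟩, h⟩)
      · rw [← List.cons_append, List.isChain_append] at h2
        exact ⟨h1, h2.1⟩
      · obtain ⟨rfl, rfl⟩ := Prod.mk.inj h
        exact ⟨by simpa using h1, h2⟩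
  · rw [Set.disjoint_left]
    rintro ⟨i, l⟩ ⟨h1, h2⟩ ⟨⟨j, l'⟩, -, h⟩
    obtain ⟨rfl, rfl⟩ := Prod.mk.inj h
    simp only [← List.cons_append] at h2
    rw [List.isChain_append] at h2
    have := h2.2.2 j (by rw [List.getLast?_concat]; rfl) j rfl
    exact this rfl
  · rintro ⟨i, l⟩ _ ⟨j, l'⟩ _ h
    obtain ⟨rfl, h⟩ := Prod.mk.inj h
    simpa using h
  · rintro ⟨i, l⟩ _
    simp only [wordWeight_append, wordWeight_cons, wordWeight_nil, add_zero, Finsupp.single_add]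
    abel

/-- The merging argument for sets: the extra index is outside the set, or is removed from it and its
weight grows by one. -/
theorem powerSumSucc_mul_elemSymm (m k : ℕ) :
    powerSumSucc K k * elemSymm K m =
      weightedSetSum K (m + 1) k + weightedSetSum K m (k + 1) := by
  have hfin := finite_add_eq (finite_single_eq k) finite_setWeight_eq
  rw [powerSumSucc, elemSymm_eq, monomialSumOn_mul (finite_single_eq k) finite_setWeight_eq]
  cases m with
  | zero =>
    rw [weightedSetSum, weightedSetSum, add_zero]
    congr 1
    ext ⟨i, s⟩
    simp only [card_eq_zero, Set.mem_prod, Set.mem_univ, Set.mem_ofPred_eq, true_and]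
    constructor
    · rintro rfl; simp
    · exact And.left
  | succ m =>
    rw [weightedSetSum, weightedSetSum, ← monomialSumOn_image
      (w := fun p : ℕ × Finset ℕ => Finsupp.single p.1 (k + 1 + 1) + setWeight p.2)
      (w' := fun p : ℕ × Finset ℕ => Finsupp.single p.1 (k + 1) + setWeight p.2)
      (fun p : ℕ × Finset ℕ => (p.1, insert p.1 p.2)), ← monomialSumOn_union hfin]
    · congr 1
      ext ⟨i, s⟩
      constructor
      · rintro ⟨-, h1⟩
        have h1 : s.card = m + 1 := h1
        by_cases hi : i ∈ s
        · refine Or.inr ⟨(i, s.erase i), ⟨?_, notMem_erase i s⟩, ?_⟩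
          · rw [card_erase_of_mem hi, h1, Nat.add_sub_cancel]
          · simp [insert_erase hi]
        · exact Or.inl ⟨h1, hi⟩
      · rintro (⟨h1, h2⟩ | ⟨⟨j, s'⟩, ⟨h1, h2⟩, h⟩)
        · exact ⟨trivial, h1⟩
        · obtain ⟨rfl, rfl⟩ := Prod.mk.inj h
          exact ⟨trivial, by simp only [Set.mem_ofPred_eq]; rw [card_insert_of_notMem h2, h1]⟩
    · rw [Set.disjoint_left]
      rintro ⟨i, s⟩ ⟨h1, h2⟩ ⟨⟨j, s'⟩, -, h⟩
      obtain ⟨rfl, rfl⟩ := Prod.mk.inj h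
      exact h2 (mem_insert_self _ _)
    · rintro ⟨i, s⟩ ⟨-, h1⟩ ⟨j, s'⟩ ⟨-, h2⟩ h
      obtain ⟨rfl, h⟩ := Prod.mk.inj h
      simp only at h h1 h2
      rw [← erase_insert h1, h, erase_insert h2]
    · rintro ⟨i, s⟩ ⟨-, h⟩
      simp only [setWeight, sum_insert h, Finsupp.single_add, add_assoc]

theorem weightedSetSum_succ_zero (m : ℕ) :
    weightedSetSum K (m + 1) 0 = (m + 1 : MvPowerSeries ℕ K) * elemSymm K (m + 1) := by
  rw [weightedSetSum, elemSymm_eq, ← monomialSumOn_image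
    (w' := fun p : ℕ × Finset ℕ => setWeight p.2) (fun p : ℕ × Finset ℕ => (p.1, insert p.1 p.2))]
  · have himage : (fun p : ℕ × Finset ℕ => (p.1, insert p.1 p.2)) ''
        {p | p.2.card = m ∧ p.1 ∉ p.2} = {p : ℕ × Finset ℕ | p.2.card = m + 1 ∧ p.1 ∈ p.2} := by
      ext ⟨i, s⟩
      constructor
      · rintro ⟨⟨j, s'⟩, ⟨h1, h2⟩, h⟩
        obtain ⟨rfl, rfl⟩ := Prod.mk.inj h
        exact ⟨by simp only; rw [card_insert_of_notMem h2, h1], mem_insert_self _ _⟩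
      · rintro ⟨h1, h2⟩
        refine ⟨(i, s.erase i), ⟨?_, notMem_erase i s⟩, ?_⟩
        · rw [card_erase_of_mem h2, h1, Nat.add_sub_cancel]
        · simp only at h2 ⊢
          rw [insert_erase h2]
    rw [himage]
    ext d
    rw [← Nat.cast_succ, ← nsmul_eq_mul, map_nsmul, coeff_monomialSumOn, coeff_monomialSumOn,
      nsmul_eq_mul, ← Nat.cast_mul]
    congr 1
    -- A set is determined by its weight, so a monomial comes from exactly one set, with m + 1
    -- choices of the marked element, or from none.
    by_cases hd : ∃ s : Finset ℕ, s.card = m + 1 ∧ setWeight s = d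
    · obtain ⟨s, hs, rfl⟩ := hd
      have h1 : {p : ℕ × Finset ℕ | p ∈ {p : ℕ × Finset ℕ | p.2.card = m + 1 ∧ p.1 ∈ p.2} ∧
          setWeight p.2 = setWeight s} = (s : Set ℕ) ×ˢ {s} := by
        ext ⟨i, t⟩
        simp only [Set.mem_ofPred_eq, setWeight_injective.eq_iff, Set.mem_prod, mem_coe,
          Set.mem_singleton_iff]
        constructor
        · rintro ⟨⟨-, h⟩, rfl⟩
          exact ⟨h, rfl⟩
        · rintro ⟨h, rfl⟩
          exact ⟨⟨hs, h⟩, rfl⟩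
      have h2 : {a : Finset ℕ | a ∈ {s : Finset ℕ | s.card = m + 1} ∧
          setWeight a = setWeight s} = {s} := by
        ext t
        simp only [Set.mem_ofPred_eq, setWeight_injective.eq_iff, Set.mem_singleton_iff]
        constructor
        · exact And.right
        · rintro rfl
          exact ⟨hs, rfl⟩
      rw [h1, h2, Set.ncard_prod, Set.ncard_singleton, Set.ncard_coe_finset, hs]
    · have h1 : {p : ℕ × Finset ℕ | p ∈ {p : ℕ × Finset ℕ | p.2.card = m + 1 ∧ p.1 ∈ p.2} ∧
          setWeight p.2 = d} = ∅ := by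
        ext ⟨i, t⟩
        simp only [Set.mem_ofPred_eq, Set.mem_empty_iff_false, iff_false]
        exact fun h => hd ⟨t, h.1.1, h.2⟩
      have h2 : {a : Finset ℕ | a ∈ {s : Finset ℕ | s.card = m + 1} ∧ setWeight a = d} = ∅ := by
        ext t
        simp only [Set.mem_ofPred_eq, Set.mem_empty_iff_false, iff_false]
        exact fun h => hd ⟨t, h⟩
      rw [h1, h2, Set.ncard_empty, Set.ncard_empty, Nat.mul_zero]
  · rintro ⟨i, s⟩ ⟨-, h1⟩ ⟨j, s'⟩ ⟨-, h2⟩ h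
    obtain ⟨rfl, h⟩ := Prod.mk.inj h
    simp only at h h1 h2
    rw [← erase_insert h1, h, erase_insert h2]
  · rintro ⟨i, s⟩ ⟨-, h⟩
    simp only [setWeight, sum_insert h, zero_add]

theorem chromaticSymm_cycleGraph (n : ℕ) :
    chromaticSymm K (SimpleGraph.cycleGraph (n + 2)) = weightedCycleSum K (n + 1) 0 := by
  have hinj : Function.Injective fun κ : (SimpleGraph.cycleGraph (n + 2)).Coloring ℕ =>
      (κ 0, List.ofFn fun i : Fin (n + 1) => κ i.succ) := by
    intro κ κ' h
    obtain ⟨h0, h⟩ := Prod.mk.inj h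
    rw [List.ofFn_inj] at h
    refine DFunLike.ext _ _ fun v => ?_
    exact Fin.cases h0 (fun i => congr_fun h i) v
  have hw : ∀ κ : (SimpleGraph.cycleGraph (n + 2)).Coloring ℕ,
      ∑ v, Finsupp.single (κ v) 1 = Finsupp.single (κ 0) (0 + 1) +
        wordWeight (List.ofFn fun i : Fin (n + 1) => κ i.succ) := by
    intro κ
    rw [Fin.sum_univ_succ, wordWeight, List.map_ofFn, List.sum_ofFn]
    rfl
  have := monomialSum_eq_monomialSumOn (K := K) _ hinj
    fun p => Finsupp.single p.1 (0 + 1) + wordWeight p.2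
  rw [chromaticSymm]
  simp only [hw]
  rw [this, weightedCycleSum]
  congr 1
  -- Repeating the first letter at the end makes the chain condition run over all edges v, v + 1 of
  -- the cycle, the last one wrapping around in `Fin (n + 2)`.
  have hchain : ∀ f : Fin (n + 2) → ℕ,
      (f 0 :: ((List.ofFn fun i : Fin (n + 1) => f i.succ) ++ [f 0])).IsChain (· ≠ ·) ↔
        ∀ v, f v ≠ f (v + 1) := by
    intro f
    rw [← List.cons_append, ← List.ofFn_succ, List.isChain_iff_getElem]
    simp only [List.length_append, List.length_ofFn, List.length_cons, List.length_nil]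
    constructor
    · intro h v
      have := h v (by omega)
      rw [List.getElem_append_left (by rw [List.length_ofFn]; exact v.isLt)] at this
      rcases Fin.eq_castSucc_or_eq_last v with ⟨w, rfl⟩ | rfl
      · rw [List.getElem_append_left (by rw [List.length_ofFn, Fin.val_castSucc]; omega)] at this
        simp only [List.getElem_ofFn] at this
        convert this using 2
        ext
        simp [Fin.coeSucc_eq_succ]
      · rw [List.getElem_append_right (by simp)] at this
        rw [List.getElem_ofFn, List.getElem_singleton] at this
        rw [Fin.last_add_one]
        exact this
    · intro h i hi
      rw [List.getElem_append_left (by simp; omega)]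
      have hv := h ⟨i, by omega⟩
      by_cases hi' : i + 1 < n + 2
      · rw [List.getElem_append_left (by simpa using hi')]
        simp only [List.getElem_ofFn]
        convert hv using 2
        ext
        rw [Fin.val_add_one_of_lt (by rw [Fin.lt_def]; simp; omega)]
      · rw [List.getElem_append_right (by simp; omega)]
        simp only [List.getElem_ofFn, List.getElem_singleton]
        have : i = n + 1 := by omega
        subst this
        convert hv using 2
        exact (Fin.last_add_one (n + 1)).symm
  ext ⟨i, l⟩
  constructor
  · rintro ⟨κ, h⟩
    obtain ⟨rfl, rfl⟩ := Prod.mk.inj h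
    refine ⟨by simp, (hchain κ).2 fun v => κ.valid ?_⟩
    rw [SimpleGraph.cycleGraph_adj]
    simp
  · rintro ⟨h1, h2⟩
    have h1 : l.length = n + 1 := h1
    set f : Fin (n + 2) → ℕ := fun v => (i :: l)[v.val]'(by rw [List.length_cons, h1]; exact v.isLt) with hf
    have hl : (List.ofFn fun i : Fin (n + 1) => f i.succ) = l := by
      apply List.ext_getElem
      · simp [h1]
      · intro j _ _
        rw [List.getElem_ofFn]
        rfl
    have hv := (hchain f).1 (by rw [hl]; exact h2)
    refine ⟨⟨f, fun {u v} h => ?_⟩, ?_⟩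
    · rw [SimpleGraph.cycleGraph_adj] at h
      rcases h with h | h
      · rw [sub_eq_iff_eq_add'] at h
        subst h
        exact (by simpa [add_comm] using (hv v).symm)
      · rw [sub_eq_iff_eq_add'] at h
        subst h
        exact (by simpa [add_comm] using hv u)
    · exact Prod.ext rfl hl

end Series

/-! ### Solving the merging recurrences -/

section AlternatingSums

variable {R : Type*} [CommRing R]

theorem alternating_sum_of_add {a b : ℕ → ℕ → R} (h : ∀ n k, b n k = a (n + 1) k + a n (k + 1))
    (h0 : ∀ k, a 0 k = 0) (n k : ℕ) :
    a (n + 1) k = ∑ j ∈ range (n + 1), (-1) ^ j * b (n - j) (k + j) := by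
  induction n generalizing k with
  | zero => simp [h, h0]
  | succ n ih =>
    have h1 := h (n + 1) k
    rw [ih] at h1
    rw [sum_range_succ', eq_sub_of_add_eq h1.symm]
    have : ∀ j ∈ range (n + 1), (-1 : R) ^ (j + 1) * b (n + 1 - (j + 1)) (k + (j + 1)) =
        -((-1) ^ j * b (n - j) (k + 1 + j)) := by
      intro j _
      rw [Nat.add_sub_add_right, pow_succ, show k + (j + 1) = k + 1 + j by ring]
      ring
    rw [sum_congr rfl this, sum_neg_distrib]
    simp
    ring

/-- Unrolling gives y n k = Σ_{i<n} (-1)^i a (n+1-i) (k+i). Expanding each a, the product p (k+j) q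
(n-j) arises once for every i ≤ j, whence the factor j + 1. The value i = n is missing since y
vanishes at 0; its contribution would be (-1)^n p (k+n), which is subtracted. -/
theorem weighted_alternating_sum_of_add {a y : ℕ → ℕ → R} {p q : ℕ → R}
    (ha : ∀ n k, a (n + 1) k = ∑ j ∈ range (n + 1), (-1) ^ j * (p (k + j) * q (n - j)))
    (hq : q 0 = 1) (hy : ∀ n k, a (n + 2) k = y (n + 1) k + y n (k + 1)) (h0 : ∀ k, y 0 k = 0)
    (n k : ℕ) :
    y n k = ∑ j ∈ range (n + 1), (j + 1) * ((-1) ^ j * (p (k + j) * q (n - j))) -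
      (-1) ^ n * p (k + n) := by
  induction n generalizing k with
  | zero => simp [h0, hq]
  | succ n ih =>
    have h1 := hy n k
    rw [ih, ha] at h1
    rw [eq_sub_of_add_eq h1.symm]
    have : ∀ j ∈ range (n + 1), (((j + 1 : ℕ) : R) + 1) *
          ((-1) ^ (j + 1) * (p (k + (j + 1)) * q (n + 1 - (j + 1)))) =
        (-1) ^ (j + 1) * (p (k + (j + 1)) * q (n + 1 - (j + 1))) -
          (j + 1) * ((-1) ^ j * (p (k + 1 + j) * q (n - j))) := by
      intro j _
      rw [Nat.add_sub_add_right, show k + (j + 1) = k + 1 + j by ring]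
      push_cast
      ring
    rw [sum_range_succ' _ (n + 1), sum_range_succ' _ (n + 1), sum_congr rfl this,
      sum_sub_distrib, show k + (n + 1) = k + 1 + n by ring]
    simp
    ring

end AlternatingSums

/-! ### The Euler operator -/

namespace PowerSeries

/-- The Euler operator `t d/dt`. -/
def euler {R : Type*} [CommRing R] (f : PowerSeries R) : PowerSeries R :=
  X * derivative R f

variable {R : Type*} [CommRing R]

theorem coeff_euler (f : PowerSeries R) (n : ℕ) : coeff n (euler f) = n * coeff n f := by
  cases n with
  | zero => simp [euler]
  | succ n =>
    rw [euler, coeff_succ_X_mul, coeff_derivative]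
    push_cast
    ring

theorem euler_mul (f g : PowerSeries R) : euler (f * g) = f * euler g + g * euler f := by
  rw [euler, euler, euler, Derivation.leibniz]
  simp only [smul_eq_mul]
  ring

theorem coeff_mk_mul (f g : ℕ → R) (n : ℕ) :
    coeff n (mk f * mk g) = ∑ j ∈ range (n + 1), f j * g (n - j) := by
  rw [coeff_mul, Nat.sum_antidiagonal_eq_sum_range_succ_mk]
  simp

end PowerSeries

/-! ### Generating functions of paths and cycles -/

section CycleSeries

open PowerSeries

variable (K : Type*) [Field K]

/-- The generating function `∑ e_k t^k`. -/
def elemSymmSeries : PowerSeries (MvPowerSeries ℕ K) := PowerSeries.mk (elemSymm K)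

/-- The generating function `∑ X_{P_n} t^n`. -/
def pathSeries : PowerSeries (MvPowerSeries ℕ K) := PowerSeries.mk (pathSum K)

/-- The generating function `∑_{k ≥ 0} (-1)^k p_{k+1} t^k`. -/
def powerSumSeries : PowerSeries (MvPowerSeries ℕ K) :=
  PowerSeries.mk fun k => (-1) ^ k * powerSumSucc K k

/-- The generating function `∑ X_{C_n} t^n`. -/
def cycleSeries : PowerSeries (MvPowerSeries ℕ K) :=
  X * PowerSeries.mk fun n => weightedCycleSum K n 0

theorem weightedPathSum_succ (n k : ℕ) :
    weightedPathSum K (n + 1) k =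
      ∑ j ∈ range (n + 1), (-1) ^ j * (powerSumSucc K (k + j) * pathSum K (n - j)) :=
  alternating_sum_of_add (a := weightedPathSum K)
    (b := fun n k => powerSumSucc K k * pathSum K n) (powerSumSucc_mul_pathSum K) (fun _ => rfl) n k

/-- Newton's identities: marking an element of a set multiplies e_m by m, and the merging recurrence
expands the marked sum. -/
theorem euler_elemSymmSeries :
    euler (elemSymmSeries K) = X * powerSumSeries K * elemSymmSeries K := by
  ext1 n
  rw [coeff_euler]
  cases n with
  | zero => simp [mul_assoc]
  | succ n =>
    rw [mul_assoc, coeff_succ_X_mul, elemSymmSeries, powerSumSeries, coeff_mk_mul, coeff_mk,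
      Nat.cast_succ, ← weightedSetSum_succ_zero, alternating_sum_of_add (a := weightedSetSum K)
      (powerSumSucc_mul_elemSymm K) (fun _ => rfl)]
    exact sum_congr rfl fun j _ => by rw [zero_add, mul_assoc]

theorem pathSeries_eq : pathSeries K = 1 + X * powerSumSeries K * pathSeries K := by
  ext1 n
  rw [map_add]
  cases n with
  | zero => simp [mul_assoc, pathSeries, pathSum_zero]
  | succ n =>
    rw [mul_assoc, coeff_succ_X_mul, pathSeries, powerSumSeries, coeff_mk_mul, coeff_mk,
      pathSum_succ, weightedPathSum_succ, coeff_one, if_neg (Nat.succ_ne_zero n), zero_add]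
    exact sum_congr rfl fun j _ => by rw [zero_add, mul_assoc]

theorem cycleSeries_eq :
    cycleSeries K = euler (X * powerSumSeries K) * pathSeries K - X * powerSumSeries K := by
  have h : euler (X * powerSumSeries K) =
      X * PowerSeries.mk fun k => (k + 1 : MvPowerSeries ℕ K) * ((-1) ^ k * powerSumSucc K k) := by
    ext1 n
    rw [coeff_euler]
    cases n with
    | zero => simp
    | succ n =>
      rw [coeff_succ_X_mul, coeff_succ_X_mul, powerSumSeries, coeff_mk, coeff_mk, Nat.cast_succ]
  rw [h, cycleSeries, mul_assoc, ← mul_sub]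
  congr 1
  ext1 n
  rw [map_sub, pathSeries, coeff_mk_mul, powerSumSeries, coeff_mk, coeff_mk,
    weighted_alternating_sum_of_add (weightedPathSum_succ K) (pathSum_zero K)
      (weightedPathSum_eq_add K) (weightedCycleSum_zero K), zero_add]
  congr 1
  exact sum_congr rfl fun j _ => by rw [zero_add, mul_assoc, mul_assoc]

/-- Eliminates the power sums and the path series: E - θE = (1 - P)E and A(1 - P) = 1, while θ²E =
EθP + PθE. -/
theorem cycleSeries_mul :
    cycleSeries K * (elemSymmSeries K - euler (elemSymmSeries K)) =
      euler (euler (elemSymmSeries K)) - euler (elemSymmSeries K) := by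
  have h1 := euler_elemSymmSeries K
  have h2 := pathSeries_eq K
  have h3 := cycleSeries_eq K
  have h4 := congrArg euler h1
  rw [euler_mul] at h4
  rw [h4, h3]
  generalize X * powerSumSeries K = P at *
  generalize euler P = P' at *
  generalize pathSeries K = A at *
  generalize elemSymmSeries K = E at *
  rw [h1]
  linear_combination (P' * E) * h2

end CycleSeries

/-! ### Coarsenings of compositions as lists -/

/-- The partial sums of a list of natural numbers. -/
def List.prefixSums (l : List ℕ) : Set ℕ := Set.range fun i => (l.take i).sum

theorem List.mem_prefixSums_nil {x : ℕ} : x ∈ ([] : List ℕ).prefixSums ↔ x = 0 := by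
  simp [List.prefixSums]

theorem List.mem_prefixSums_cons {a x : ℕ} {l : List ℕ} :
    x ∈ (a :: l).prefixSums ↔ x = 0 ∨ ∃ y ∈ l.prefixSums, x = a + y := by
  constructor
  · rintro ⟨i, rfl⟩
    cases i with
    | zero => simp
    | succ i => exact Or.inr ⟨_, ⟨i, rfl⟩, by simp⟩
  · rintro (rfl | ⟨_, ⟨i, rfl⟩, rfl⟩)
    · exact ⟨0, by simp⟩
    · exact ⟨i + 1, by simp⟩

theorem List.zero_mem_prefixSums (l : List ℕ) : 0 ∈ l.prefixSums := ⟨0, by simp⟩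

theorem Composition.mem_boundaries_iff {n : ℕ} (c : Composition n) (x : Fin (n + 1)) :
    x ∈ c.boundaries ↔ (x : ℕ) ∈ c.blocks.prefixSums := by
  rw [Composition.boundaries, Finset.mem_map]
  constructor
  · rintro ⟨i, -, rfl⟩
    exact ⟨i, rfl⟩
  · rintro ⟨i, hi⟩
    -- `take` accepts any index, a boundary only those up to the length; beyond it the partial sum
    -- is constant.
    refine ⟨⟨min i c.length, by omega⟩, mem_univ _, Fin.ext ?_⟩
    rw [← hi]
    change (c.blocks.take (min i c.length)).sum = _
    rw [← List.take_take, Composition.length, List.take_length]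

theorem Composition.isCoarsening_iff {n : ℕ} (J I : Composition n) :
    J.IsCoarsening I ↔ J.blocks.prefixSums ⊆ I.blocks.prefixSums := by
  constructor
  · rintro h _ ⟨i, rfl⟩
    have hlt : (J.blocks.take i).sum < n + 1 := by
      have := List.sum_take_add_sum_drop J.blocks i
      have := J.blocks_sum
      omega
    have := h ((J.mem_boundaries_iff ⟨_, hlt⟩).2 ⟨i, rfl⟩)
    exact (I.mem_boundaries_iff _).1 this
  · intro h x hx
    exact (I.mem_boundaries_iff x).2 (h ((J.mem_boundaries_iff x).1 hx))

/-- The coarsenings of the list `a :: l`. -/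
def coarsenings : ℕ → List ℕ → Finset (List ℕ)
  | a, [] => {[a]}
  | a, b :: l => (coarsenings b l).image (a :: ·) ∪ coarsenings (a + b) l

theorem List.eq_nil_of_pos_of_sum_eq_zero {l : List ℕ} (h : ∀ x ∈ l, 0 < x) (h0 : l.sum = 0) :
    l = [] := by
  cases l with
  | nil => rfl
  | cons a l =>
    have := h a List.mem_cons_self
    rw [List.sum_cons] at h0
    omega

/-- The recursion decides whether the cut after a is kept. The first part of J is a partial sum of
`a :: l`, so it is at least a; equality means that the cut is kept, and otherwise a is not a partial
sum of J and may be merged with the next part. -/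
theorem mem_coarsenings {a : ℕ} {l J : List ℕ} (ha : 0 < a) (hl : ∀ x ∈ l, 0 < x) :
    J ∈ coarsenings a l ↔
      (∀ x ∈ J, 0 < x) ∧ J.sum = a + l.sum ∧ J.prefixSums ⊆ (a :: l).prefixSums := by
  induction l generalizing a J with
  | nil =>
    rw [coarsenings, mem_singleton]
    constructor
    · rintro rfl
      simp [ha]
    · rintro ⟨h1, h2, h3⟩
      cases J with
      | nil => simp at h2; omega
      | cons c J =>
        have hc := h1 c List.mem_cons_self
        have h4 := h3 (List.mem_prefixSums_cons.2 (Or.inr ⟨0, J.zero_mem_prefixSums, rfl⟩))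
        simp only [List.mem_prefixSums_cons, List.mem_prefixSums_nil] at h4
        obtain h4 | ⟨y, rfl, h4⟩ := h4
        · omega
        · simp only [List.sum_cons, List.sum_nil] at h2
          rw [List.eq_nil_of_pos_of_sum_eq_zero (l := J)
            (fun x hx => h1 x (List.mem_cons_of_mem _ hx)) (by omega)]
          congr 1
  | cons b l ih =>
    have hb : 0 < b := hl b List.mem_cons_self
    have hl' : ∀ x ∈ l, 0 < x := fun x hx => hl x (List.mem_cons_of_mem _ hx)
    rw [coarsenings, mem_union, mem_image, ih (by omega) hl']
    constructor
    · rintro (⟨J, hJ, rfl⟩ | ⟨h1, h2, h3⟩)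
      · rw [ih hb hl'] at hJ
        obtain ⟨h1, h2, h3⟩ := hJ
        refine ⟨?_, by simp [h2], ?_⟩
        · simpa using ⟨ha, h1⟩
        · intro x hx
          rw [List.mem_prefixSums_cons] at hx ⊢
          exact hx.imp_right fun ⟨y, hy, h⟩ => ⟨y, h3 hy, h⟩
      · refine ⟨h1, by simp [h2, add_assoc], fun x hx => ?_⟩
        have := h3 hx
        rw [List.mem_prefixSums_cons] at this ⊢
        refine this.imp_right ?_
        rintro ⟨y, hy, rfl⟩
        exact ⟨b + y, List.mem_prefixSums_cons.2 (Or.inr ⟨y, hy, rfl⟩), add_assoc _ _ _⟩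
    · rintro ⟨h1, h2, h3⟩
      cases J with
      | nil => simp at h2; omega
      | cons c J =>
        have hc := h1 c List.mem_cons_self
        have h4 := h3 (List.mem_prefixSums_cons.2 (Or.inr ⟨0, J.zero_mem_prefixSums, rfl⟩))
        have hca : a ≤ c := by
          rw [List.mem_prefixSums_cons] at h4
          obtain h4 | ⟨y, _, h4⟩ := h4 <;> omega
        by_cases hac : c = a
        · subst hac
          refine Or.inl ⟨J, (ih hb hl').2 ⟨fun x hx => h1 x (List.mem_cons_of_mem _ hx), ?_, ?_⟩,
            rfl⟩
          · simp only [List.sum_cons] at h2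
            omega
          · intro x hx
            have h5 := h3 (List.mem_prefixSums_cons.2 (Or.inr ⟨x, hx, rfl⟩))
            rw [List.mem_prefixSums_cons] at h5
            obtain h5 | ⟨y, hy, h5⟩ := h5
            · omega
            · rwa [Nat.add_left_cancel h5]
        · refine Or.inr ⟨h1, by simpa [add_assoc] using h2, fun x hx => ?_⟩
          have hxa : x ≠ a := by
            rw [List.mem_prefixSums_cons] at hx
            obtain hx | ⟨y, _, hx⟩ := hx <;> omega
          have h5 := h3 hx
          rw [List.mem_prefixSums_cons] at h5 ⊢
          refine h5.imp_right ?_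
          rintro ⟨y, hy, rfl⟩
          rw [List.mem_prefixSums_cons] at hy
          obtain rfl | ⟨z, hz, rfl⟩ := hy
          · omega
          · exact ⟨z, hz, (add_assoc _ _ _).symm⟩

theorem sum_coarsenings_cons {M : Type*} [AddCommMonoid M] {a b : ℕ} {l : List ℕ} (ha : 0 < a)
    (hb : 0 < b) (hl : ∀ x ∈ l, 0 < x) (f : List ℕ → M) :
    ∑ J ∈ coarsenings a (b :: l), f J =
      ∑ J ∈ coarsenings b l, f (a :: J) + ∑ J ∈ coarsenings (a + b) l, f J := by
  rw [coarsenings, sum_union, sum_image]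
  · intro x _ y _ h
    simpa using h
  · rw [Finset.disjoint_left]
    rintro J h1 h2
    obtain ⟨J, -, rfl⟩ := mem_image.1 h1
    rw [mem_coarsenings (by omega) hl] at h2
    have := h2.2.2 (List.mem_prefixSums_cons.2 (Or.inr ⟨0, J.zero_mem_prefixSums, rfl⟩))
    rw [List.mem_prefixSums_cons] at this
    obtain h | ⟨y, _, h⟩ := this <;> omega

/-- Replaces n - ℓ by n + ℓ, of the same parity, so that the sign is additive along lists and free
of truncated subtraction. -/
theorem Composition.sgn_eq {n : ℕ} (I : Composition n) :
    I.sgn = (-1) ^ (I.blocks.sum + I.blocks.length) := by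
  rw [Composition.sgn, I.blocks_sum]
  have h : n + I.blocks.length = n - I.length + 2 * I.length := by
    have := I.length_le
    have : I.length = I.blocks.length := rfl
    omega
  rw [h, pow_add, pow_mul]
  simp

/-! ### Ribbons: recursion, product rule and elementary functions -/

namespace NSym

variable (K : Type*) [Field K]

/-- The ribbon Schur function of the nonempty list `a :: l`, by recursion on `l`. -/
def ribbonCons : ℕ → List ℕ → NSym K
  | a, [] => complete K a
  | a, b :: l => complete K a * ribbonCons b l - ribbonCons (a + b) l

/-- The ribbon Schur function of a list. -/
def ribbonList : List ℕ → NSym K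
  | [] => 1
  | a :: l => ribbonCons K a l

/-- Coarsenings that keep the first cut contribute S_a times a shorter ribbon; those that merge it
contribute a ribbon with one part fewer, hence the opposite sign. -/
theorem ribbonCons_eq_sum {a : ℕ} {l : List ℕ} (ha : 0 < a) (hl : ∀ x ∈ l, 0 < x) :
    ribbonCons K a l = ((-1 : ℤ) ^ ((a :: l).sum + (a :: l).length)) •
      ∑ J ∈ coarsenings a l, ((-1 : ℤ) ^ (J.sum + J.length)) • (J.map (complete K)).prod := by
  induction l generalizing a with
  | nil =>
    rw [coarsenings, sum_singleton, smul_smul, ← mul_pow]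
    simp [ribbonCons]
  | cons b l ih =>
    have hb : 0 < b := hl b List.mem_cons_self
    have hl' : ∀ x ∈ l, 0 < x := fun x hx => hl x (List.mem_cons_of_mem _ hx)
    have h1 : ∀ J : List ℕ, ((-1 : ℤ) ^ ((a :: J).sum + (a :: J).length)) •
        ((a :: J).map (complete K)).prod = ((-1 : ℤ) ^ (a + 1)) • (complete K a *
          (((-1 : ℤ) ^ (J.sum + J.length)) • (J.map (complete K)).prod)) := by
      intro J
      rw [mul_smul_comm, smul_smul, ← pow_add]
      simp only [List.sum_cons, List.length_cons, List.map_cons, List.prod_cons]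
      congr 2
      ring
    have h2 : (-1 : ℤ) ^ ((a :: b :: l).sum + (a :: b :: l).length) =
        (-1) ^ ((b :: l).sum + (b :: l).length) * (-1) ^ (a + 1) := by
      rw [← pow_add]
      simp only [List.sum_cons, List.length_cons]
      congr 1
      ring
    have h3 : (-1 : ℤ) ^ ((a :: b :: l).sum + (a :: b :: l).length) =
        -(-1) ^ (((a + b) :: l).sum + ((a + b) :: l).length) := by
      simp only [List.sum_cons, List.length_cons]
      ring
    rw [sum_coarsenings_cons ha hb hl', sum_congr rfl fun J _ => h1 J, ← smul_sum, ← mul_sum,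
      smul_add, ribbonCons, ih hb hl', ih (by omega) hl', sub_eq_add_neg]
    congr 1
    · rw [h2, smul_smul, mul_assoc, ← pow_add, ← two_mul, pow_mul, mul_smul_comm]
      simp
    · rw [h3, neg_smul]

theorem ribbon_eq_ribbonList {n : ℕ} (hn : 0 < n) (I : Composition n) :
    ribbon K I = ribbonList K I.blocks := by
  classical
  obtain ⟨a, l, hI⟩ : ∃ a l, I.blocks = a :: l := by
    have := I.blocks_sum
    cases h : I.blocks with
    | nil =>
      rw [h, List.sum_nil] at this
      omega
    | cons a l => exact ⟨a, l, rfl⟩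
  have hpos : ∀ x ∈ I.blocks, 0 < x := fun x hx => I.blocks_pos hx
  rw [hI] at hpos
  have ha : 0 < a := hpos a List.mem_cons_self
  have hl : ∀ x ∈ l, 0 < x := fun x hx => hpos x (List.mem_cons_of_mem _ hx)
  have hsum : a + l.sum = n := by rw [← I.blocks_sum, hI, List.sum_cons]
  rw [ribbon, hI, ribbonList, ribbonCons_eq_sum K ha hl, Composition.sgn_eq, hI]
  congr 1
  refine sum_nbij (fun J : Composition n => J.blocks) ?_ ?_ ?_ ?_
  · intro J hJ
    rw [mem_filter, Composition.isCoarsening_iff, hI] at hJ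
    rw [mem_coarsenings ha hl]
    exact ⟨fun x hx => J.blocks_pos hx, by rw [J.blocks_sum, hsum], hJ.2⟩
  · intro J _ J' _ h
    exact Composition.ext h
  · intro J hJ
    rw [mem_coe, mem_coarsenings ha hl] at hJ
    obtain ⟨h1, h2, h3⟩ := hJ
    refine ⟨⟨J, fun {x} hx => h1 x hx, h2.trans hsum⟩, ?_, rfl⟩
    simp only [coe_filter, mem_univ, true_and, Set.mem_ofPred_eq, Composition.isCoarsening_iff,
      hI]
    exact h3
  · intro J _
    rw [Composition.sgn_eq, completeProd]

theorem ribbonCons_append_mul (a c b : ℕ) (l J : List ℕ) :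
    ribbonCons K a (l ++ [c]) * ribbonCons K b J =
      ribbonCons K a (l ++ c :: b :: J) + ribbonCons K a (l ++ (c + b) :: J) := by
  induction l generalizing a with
  | nil =>
    simp only [List.nil_append, ribbonCons, add_assoc]
    noncomm_ring
  | cons d l ih =>
    simp only [List.cons_append, ribbonCons, sub_mul, mul_assoc, ih]
    noncomm_ring

theorem ribbonList_append_mul (c b : ℕ) (l J : List ℕ) :
    ribbonList K (l ++ [c]) * ribbonList K (b :: J) =
      ribbonList K (l ++ c :: b :: J) + ribbonList K (l ++ (c + b) :: J) := by
  cases l with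
  | nil => simp [ribbonList, ribbonCons]
  | cons a l => exact ribbonCons_append_mul K a c b l J

theorem complete_zero : complete K 0 = 1 := by
  simp [complete]

theorem sum_elem_mul_complete (n : ℕ) :
    ∑ i ∈ range (n + 2), (-1) ^ i * elem K i * complete K (n + 1 - i) = 0 := by
  have h := PowerSeries.mul_invOfUnit (elemSeriesNeg K) 1 (by simp [elemSeriesNeg, elem])
  have h := congrArg (PowerSeries.coeff (n + 1)) h
  rw [PowerSeries.coeff_mul, Nat.sum_antidiagonal_eq_sum_range_succ_mk, PowerSeries.coeff_one,
    if_neg (Nat.succ_ne_zero n)] at h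
  rw [← h]
  refine sum_congr rfl fun i _ => ?_
  rw [elemSeriesNeg, PowerSeries.coeff_mk]
  rfl

/-- Telescoping: R_{1^i} S_m is a sum of two hooks, one of which cancels against the preceding term.
-/
theorem sum_ribbonList_mul_complete (n N : ℕ) (hN : N ≤ n) :
    ∑ i ∈ range (N + 1), (-1) ^ i * ribbonList K (List.replicate i 1) * complete K (n + 1 - i) =
      (-1) ^ N * ribbonList K (List.replicate N 1 ++ [n + 1 - N]) := by
  induction N with
  | zero => simp [ribbonList, ribbonCons]
  | succ N ih =>
    rw [sum_range_succ, ih (by omega)]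
    have h := ribbonList_append_mul K 1 (n + 1 - (N + 1)) (List.replicate N 1) []
    have h1 : 1 + (n + 1 - (N + 1)) = n + 1 - N := by omega
    rw [h1, ← List.replicate_succ'] at h
    have h2 : List.replicate N 1 ++ [1, n + 1 - (N + 1)] =
        List.replicate (N + 1) 1 ++ [n + 1 - (N + 1)] := by
      rw [List.replicate_succ', List.append_assoc]
      rfl
    rw [h2] at h
    change _ * complete K (n + 1 - (N + 1)) = _ at h
    rw [mul_assoc, h, pow_succ]
    noncomm_ring

/-- The relation Σ (-1)^i Λ_i S_{n+1-i} = 0 determines Λ_{n+1} from the earlier ones, and the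
telescoped sum shows that R_{1^(n+1)} solves it. -/
theorem elem_eq_ribbonList (n : ℕ) : elem K n = ribbonList K (List.replicate n 1) := by
  induction n using Nat.strong_induction_on with
  | _ n ih =>
    cases n with
    | zero => rfl
    | succ n =>
      have h := sum_elem_mul_complete K n
      rw [sum_range_succ, Nat.sub_self, complete_zero, mul_one,
        sum_congr rfl fun i hi => by rw [ih i (mem_range.1 hi)],
        sum_ribbonList_mul_complete K n n le_rfl, Nat.add_sub_cancel_left,
        ← List.replicate_succ', pow_succ] at h
      have h' : (-1 : NSym K) ^ n * (ribbonList K (List.replicate (n + 1) 1) - elem K (n + 1)) = 0 := by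
        rw [← h]
        noncomm_ring
      exact (sub_eq_zero.1 ((isUnit_one.neg.pow n).mul_right_eq_zero.1 h')).symm

end NSym

/-! ### Index lists of the cycle expansion -/

/-- The lists of sum `n` with entries in `{1, 2}` and last entry `1`. -/
def cycleTails : ℕ → Finset (List ℕ)
  | 0 => ∅
  | 1 => {[1]}
  | n + 2 => (cycleTails (n + 1)).image (1 :: ·) ∪ (cycleTails n).image (2 :: ·)

theorem mem_cycleTails {n : ℕ} {l : List ℕ} :
    l ∈ cycleTails n ↔ l.sum = n ∧ (∀ x ∈ l, x = 1 ∨ x = 2) ∧ l.getLast? = some 1 := by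
  induction n using cycleTails.induct generalizing l with
  | case1 =>
    simp only [cycleTails, notMem_empty, false_iff]
    rintro ⟨h1, -, h3⟩
    have := List.sum_eq_zero_iff.1 h1 1 (List.mem_of_getLast? h3)
    omega
  | case2 =>
    rw [cycleTails, mem_singleton]
    constructor
    · rintro rfl
      simp
    · rintro ⟨h1, h2, h3⟩
      match l with
      | x :: l =>
        have hx := h2 x List.mem_cons_self
        rw [List.sum_cons] at h1
        rw [List.eq_nil_of_pos_of_sum_eq_zero (l := l) (fun y hy => by
          have := h2 y (List.mem_cons_of_mem _ hy)
          omega) (by omega)]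
        congr 1
        omega
  | case3 n ih1 ih2 =>
    rw [cycleTails, mem_union, mem_image, mem_image]
    constructor
    · rintro (⟨l, hl, rfl⟩ | ⟨l, hl, rfl⟩)
      · rw [ih1] at hl
        obtain ⟨h1, h2, h3⟩ := hl
        refine ⟨by rw [List.sum_cons]; omega, by simpa using h2, ?_⟩
        rw [List.getLast?_cons, h3]
        rfl
      · rw [ih2] at hl
        obtain ⟨h1, h2, h3⟩ := hl
        refine ⟨by rw [List.sum_cons]; omega, by simpa using h2, ?_⟩
        rw [List.getLast?_cons, h3]
        rfl
    · rintro ⟨h1, h2, h3⟩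
      match l with
      | [x] =>
        simp at h1 h3
        omega
      | x :: y :: l =>
        have hx := h2 x List.mem_cons_self
        have h2' : ∀ z ∈ y :: l, z = 1 ∨ z = 2 := fun z hz => h2 z (List.mem_cons_of_mem _ hz)
        rw [List.getLast?_cons_cons] at h3
        rw [List.sum_cons] at h1
        obtain rfl | rfl := hx
        · exact Or.inl ⟨_, ih1.2 ⟨by omega, h2', h3⟩, rfl⟩
        · exact Or.inr ⟨_, ih2.2 ⟨by omega, h2', h3⟩, rfl⟩

theorem sum_cycleTails_add_two {M : Type*} [AddCommMonoid M] (n : ℕ) (f : List ℕ → M) :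
    ∑ l ∈ cycleTails (n + 2), f l =
      ∑ l ∈ cycleTails (n + 1), f (1 :: l) + ∑ l ∈ cycleTails n, f (2 :: l) := by
  rw [cycleTails, sum_union, sum_image, sum_image]
  · intro x _ y _ h
    simpa using h
  · intro x _ y _ h
    simpa using h
  · rw [Finset.disjoint_left]
    intro l h1 h2
    obtain ⟨l, -, rfl⟩ := mem_image.1 h1
    obtain ⟨l', -, h⟩ := mem_image.1 h2
    simp at h

theorem Composition.isCycleIndex_iff {n : ℕ} (I : Composition n) :
    I.IsCycleIndex ↔ I.blocks ∈ cycleTails n ∧ I.blocks.head? = some 1 := by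
  rw [Composition.IsCycleIndex, mem_cycleTails]
  constructor
  · rintro ⟨h1, h2, h3⟩
    refine ⟨⟨I.blocks_sum, fun x hx => ?_, h2⟩, h1⟩
    have hpos : 0 < x := I.blocks_pos hx
    obtain ⟨l, hl⟩ : ∃ l, I.blocks = 1 :: l := List.head?_eq_some_iff.1 h1
    rw [hl] at hx h2 h3
    rw [List.tail_cons] at h3
    obtain rfl | hx := List.mem_cons.1 hx
    · exact Or.inl rfl
    · rcases List.eq_nil_or_concat l with rfl | ⟨l, j, rfl⟩
      · simp at hx
      · rw [List.concat_eq_append] at *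
        rw [List.dropLast_concat] at h3
        rw [← List.cons_append, List.getLast?_concat] at h2
        rw [List.mem_append, List.mem_singleton] at hx
        obtain hx | rfl := hx
        · have := h3 x hx
          omega
        · exact Or.inl (Option.some.inj h2)
  · rintro ⟨⟨-, h2, h3⟩, h1⟩
    refine ⟨h1, h3, fun x hx => ?_⟩
    have := h2 x (List.mem_of_mem_tail (List.mem_of_mem_dropLast hx))
    omega

/-! ### Summation by parts twice -/

section SecondDifferences

variable {K M : Type*} [Field K] [AddCommGroup M] [Module K M]

theorem sum_smul_secondDiff (v : ℕ → M) (N : ℕ) :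
    ∑ k ∈ range N, (k : K) • (v (k + 2) - (2 : K) • v (k + 1) + v k) =
      v 1 - (N : K) • v N + ((N : K) - 1) • v (N + 1) := by
  induction N with
  | zero => simp
  | succ N ih =>
    rw [sum_range_succ, ih]
    push_cast
    module

theorem sum_mul_smul_secondDiff (v : ℕ → M) (N : ℕ) :
    ∑ k ∈ range N, (((k : K) + 1) * k) • (v (k + 2) - (2 : K) • v (k + 1) + v k) =
      (2 : K) • ∑ j ∈ range N, v (j + 1) - (((N : K) + 1) * N) • v N +
        ((N : K) * (N - 1)) • v (N + 1) := by
  induction N with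
  | zero => simp
  | succ N ih =>
    rw [sum_range_succ, ih, sum_range_succ]
    push_cast
    module

end SecondDifferences

/-! ### Recursion for the ribbon coefficients -/

/-- The coefficient of the ribbon Schur function of the list `l` in the expansion for cycles. -/
def cycleCoeff (F : Type*) [Field F] (l : List ℕ) : F :=
  2 ^ l.count 1 * (1 - 1 / 2 ^ (l.takeWhile (· = 1)).length)

theorem cycleCoeff_two_cons (F : Type*) [Field F] (l : List ℕ) : cycleCoeff F (2 :: l) = 0 := by
  simp [cycleCoeff]

theorem cycleCoeff_one_cons (F : Type*) [Field F] [CharZero F] (l : List ℕ) :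
    cycleCoeff F (1 :: l) = 2 ^ l.count 1 + cycleCoeff F l := by
  simp only [cycleCoeff, List.count_cons_self, decide_true, List.takeWhile_cons_of_pos,
    List.length_cons]
  field_simp
  ring

/-! ### The ribbon expansion of the noncommutative quotient -/

namespace NSym

variable (K : Type*) [Field K]

/-- The sum of `2^{m_1(l)} R_{1^j l}` over the lists `l` of sum `m` with entries in `{1, 2}` and
last entry `1`. -/
def tailSum (j m : ℕ) : NSym K :=
  ∑ l ∈ cycleTails m, (2 : K) ^ l.count 1 • ribbonList K (List.replicate j 1 ++ l)

theorem tailSum_zero (j : ℕ) : tailSum K j 0 = 0 := by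
  simp [tailSum, cycleTails]

theorem tailSum_one (j : ℕ) : tailSum K j 1 = (2 : K) • elem K (j + 1) := by
  rw [tailSum, cycleTails, sum_singleton, elem_eq_ribbonList, List.replicate_succ']
  simp

theorem replicate_append_one_cons (j : ℕ) (l : List ℕ) :
    List.replicate j 1 ++ 1 :: l = List.replicate (j + 1) 1 ++ l := by
  rw [List.replicate_succ', List.append_assoc]
  rfl

theorem tailSum_add_two (j m : ℕ) :
    tailSum K j (m + 2) = (2 : K) • tailSum K (j + 1) (m + 1) +
      ∑ l ∈ cycleTails m, (2 : K) ^ l.count 1 • ribbonList K (List.replicate j 1 ++ 2 :: l) := by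
  rw [tailSum, sum_cycleTails_add_two, tailSum, smul_sum]
  congr 1
  · refine sum_congr rfl fun l _ => ?_
    rw [List.count_cons_self, replicate_append_one_cons, smul_smul, pow_succ']

/-- Multiplying R_{1^(k+1)} by R_{1l} gives R_{1^(k+2) l} + R_{1^k 2 l}. The lists 2l are those left
in T(k, m+2) once the lists starting with 1, worth 2T(k+1, m+1), are removed. -/
theorem elem_mul_tailSum (k m : ℕ) :
    elem K (k + 1) * tailSum K 1 m =
      tailSum K (k + 2) m - (2 : K) • tailSum K (k + 1) (m + 1) + tailSum K k (m + 2) := by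
  rw [tailSum_add_two, ← add_assoc, sub_add_cancel, elem_eq_ribbonList, tailSum, tailSum, mul_sum,
    ← sum_add_distrib]
  refine sum_congr rfl fun l _ => ?_
  have h := ribbonList_append_mul K 1 1 (List.replicate k 1) l
  rw [← List.replicate_succ', replicate_append_one_cons, replicate_append_one_cons] at h
  rw [mul_smul_comm, ← smul_add, ← h]
  rfl

/-- The noncommutative symmetric functions `∑_{I ⊨ n} ∏ (i_j - 1) Λ^I`. -/
def cycleTailSum : ℕ → NSym K
  | 0 => 1
  | n + 1 => (2 : K)⁻¹ • tailSum K 1 n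

theorem elem_mul_cycleTailSum [CharZero K] (n k : ℕ) (hk : k ≤ n) :
    elem K (k + 1) * cycleTailSum K (n - k) = (2 : K)⁻¹ •
      (tailSum K (k + 2) (n + 1 - (k + 2)) - (2 : K) • tailSum K (k + 1) (n + 1 - (k + 1)) +
        tailSum K k (n + 1 - k)) := by
  obtain ⟨m, rfl⟩ := Nat.exists_eq_add_of_le hk
  rw [Nat.add_sub_cancel_left]
  cases m with
  -- The factor Λ_{n+1} · 1 fits the same pattern: both T(·,0) vanish and T(n,1) = 2Λ_{n+1}, which
  -- is why the factor 1/2 is needed.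
  | zero =>
    rw [show k + 0 + 1 - (k + 2) = 0 by omega, show k + 0 + 1 - (k + 1) = 0 by omega,
      show k + 0 + 1 - k = 1 by omega, tailSum_zero, tailSum_zero, tailSum_one, smul_zero, sub_zero,
      zero_add, inv_smul_smul₀ two_ne_zero, cycleTailSum, mul_one]
  | succ m =>
    rw [show k + (m + 1) + 1 - (k + 2) = m by omega, show k + (m + 1) + 1 - (k + 1) = m + 1 by omega,
      show k + (m + 1) + 1 - k = m + 2 by omega, cycleTailSum, mul_smul_comm, elem_mul_tailSum]

/-- This recursion says that the `cycleTailSum` are the coefficients of the inverse of 1 - Σ (k-1)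
Λ_k t^k. -/
theorem sum_elem_mul_cycleTailSum [CharZero K] (n : ℕ) :
    ∑ k ∈ range (n + 1), (k : K) • (elem K (k + 1) * cycleTailSum K (n - k)) =
      cycleTailSum K (n + 1) := by
  have h := sum_smul_secondDiff (K := K) (fun j => tailSum K j (n + 1 - j)) (n + 1)
  -- Both boundary terms at the upper end have second index 0 (once by truncation), so only v 1
  -- survives.
  simp only [Nat.sub_self, show n + 1 - (n + 1 + 1) = 0 by omega, tailSum_zero, smul_zero,
    sub_zero, add_zero, Nat.add_sub_cancel] at h
  rw [cycleTailSum, ← h, smul_sum]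
  refine sum_congr rfl fun k hk => ?_
  rw [elem_mul_cycleTailSum K n k (by have := mem_range.1 hk; omega), smul_comm]

theorem sum_mul_elem_mul_cycleTailSum [CharZero K] (n : ℕ) :
    ∑ k ∈ range (n + 1), (((k : K) + 1) * k) • (elem K (k + 1) * cycleTailSum K (n - k)) =
      ∑ j ∈ range (n + 1), tailSum K (j + 1) (n - j) := by
  have h := sum_mul_smul_secondDiff (K := K) (fun j => tailSum K j (n + 1 - j)) (n + 1)
  simp only [Nat.sub_self, show n + 1 - (n + 1 + 1) = 0 by omega, tailSum_zero, smul_zero,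
    sub_zero, add_zero, Nat.add_sub_add_right] at h
  rw [← inv_smul_smul₀ (two_ne_zero' K) (∑ j ∈ range (n + 1), tailSum K (j + 1) (n - j)), ← h,
    smul_sum]
  refine sum_congr rfl fun k hk => ?_
  rw [elem_mul_cycleTailSum K n k (by have := mem_range.1 hk; omega), smul_comm]
  simp only [Nat.add_sub_add_right]

/-- Each leading 1 peeled off l contributes 2 to the number of ones that remain
(`cycleCoeff_one_cons`), and a leading 2 stops the process with coefficient 0. Peeling the last 1 of
an all-ones list leaves the empty list, which no `tailSum` contains; this is the extra elementary
term. -/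
theorem sum_cycleCoeff_smul [CharZero K] (j m : ℕ) :
    ∑ l ∈ cycleTails (m + 1), cycleCoeff K l • ribbonList K (List.replicate j 1 ++ l) =
      ∑ i ∈ range (m + 1), tailSum K (j + 1 + i) (m - i) + elem K (j + m + 1) := by
  induction m generalizing j with
  | zero =>
    rw [cycleTails, sum_singleton, elem_eq_ribbonList, List.replicate_succ']
    simp [tailSum_zero, cycleCoeff]
    norm_num
  | succ m ih =>
    rw [sum_cycleTails_add_two]
    simp only [cycleCoeff_two_cons, zero_smul, sum_const_zero, add_zero, cycleCoeff_one_cons,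
      add_smul, replicate_append_one_cons, sum_add_distrib]
    rw [ih, sum_range_succ' _ (m + 1), show j + (m + 1) + 1 = j + 1 + m + 1 by ring,
      ← add_assoc]
    congr 1
    rw [add_comm]
    congr 1
    refine sum_congr rfl fun i _ => ?_
    rw [Nat.add_sub_add_right, show j + 1 + 1 + i = j + 1 + (i + 1) by ring]

-- Lists starting with 2 have no leading ones, hence coefficient 0, so the condition on the first
-- part can be dropped.
open Classical in
theorem sum_isCycleIndex [CharZero K] (n : ℕ) :
    ∑ I : Composition (n + 1) with I.IsCycleIndex,
        ((2 : K) ^ I.numOnes * (1 - 1 / 2 ^ I.leadingOnes)) • ribbon K I =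
      ∑ l ∈ cycleTails (n + 1), cycleCoeff K l • ribbonList K l := by
  rw [← sum_filter_of_ne (p := fun l : List ℕ => l.head? = some 1)]
  · refine sum_nbij (fun I : Composition (n + 1) => I.blocks) ?_ ?_ ?_ ?_
    · intro I hI
      rw [mem_filter, Composition.isCycleIndex_iff] at hI
      exact mem_filter.2 hI.2
    · intro I _ I' _ h
      exact Composition.ext h
    · intro l hl
      rw [mem_coe, mem_filter] at hl
      have h := mem_cycleTails.1 hl.1
      refine ⟨⟨l, fun {x} hx => ?_, h.1⟩, ?_, rfl⟩
      · have := h.2.1 x hx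
        omega
      · simp only [coe_filter, mem_univ, true_and, Set.mem_ofPred_eq,
          Composition.isCycleIndex_iff]
        exact hl
    · intro I _
      rw [ribbon_eq_ribbonList K (Nat.succ_pos n)]
      rfl
  · intro l hl hne
    have h := mem_cycleTails.1 hl
    match l with
    | [] => simp at h
    | x :: l =>
      obtain rfl | rfl := h.2.1 x List.mem_cons_self
      · rfl
      · rw [cycleCoeff_two_cons, zero_smul] at hne
        exact absurd rfl hne

theorem ribbon_ones (n : ℕ) (hn : 0 < n) : ribbon K (Composition.ones n) = elem K n := by
  rw [ribbon_eq_ribbonList K hn, Composition.ones_blocks, elem_eq_ribbonList]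

open Classical in
theorem cycle_ribbon_sum_eq [CharZero K] (n : ℕ) :
    (∑ I : Composition (n + 1) with I.IsCycleIndex,
        ((2 : K) ^ I.numOnes * (1 - 1 / 2 ^ I.leadingOnes)) • ribbon K I) -
        ribbon K (Composition.ones (n + 1)) =
      ∑ k ∈ range (n + 1), (((k : K) + 1) * k) • (elem K (k + 1) * cycleTailSum K (n - k)) := by
  have h := sum_cycleCoeff_smul K 0 n
  simp only [List.replicate_zero, List.nil_append, zero_add] at h
  rw [sum_isCycleIndex, h, ribbon_ones K _ (Nat.succ_pos n), add_sub_cancel_right,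
    sum_mul_elem_mul_cycleTailSum]
  exact sum_congr rfl fun i _ => by rw [add_comm]

/-! ### Commutative image of the quotient -/

theorem commImage_elem (k : ℕ) : commImage K (elem K k) = elemSymm K k := by
  cases k with
  | zero => rw [elem, map_one, elemSymm_zero]
  | succ k =>
    rw [elem, commImage, FreeAlgebra.lift_ι_apply]
    rfl

open PowerSeries in
theorem commImage_cycle [CharZero K] (n : ℕ) :
    commImage K (∑ k ∈ range (n + 2),
        (((k : K) + 1) * k) • (elem K (k + 1) * cycleTailSum K (n + 1 - k))) =
      chromaticSymm K (SimpleGraph.cycleGraph (n + 2)) := by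
  set E := elemSymmSeries K with hE
  set G : PowerSeries (MvPowerSeries ℕ K) :=
    PowerSeries.mk fun n => commImage K (cycleTailSum K n) with hG
  have hsmul : ∀ (c : K) (f : MvPowerSeries ℕ K), c • f = algebraMap K _ c * f := fun c f =>
    Algebra.smul_def c f
  -- The image of the recursion for `cycleTailSum`: G inverts E - θE, the factor that multiplies the
  -- cycle series in `cycleSeries_mul`.
  have h1 : (euler E - E) * G = -1 := by
    have : euler E - E = PowerSeries.mk fun k => ((k : MvPowerSeries ℕ K) - 1) * elemSymm K k := by
      ext1 n
      rw [map_sub, coeff_euler, hE, elemSymmSeries, coeff_mk, coeff_mk]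
      ring
    rw [this]
    ext1 n
    rw [coeff_mk_mul, map_neg]
    cases n with
    | zero => simp [elemSymm_zero, cycleTailSum]
    | succ n =>
      rw [sum_range_succ', coeff_one, if_neg (Nat.succ_ne_zero n), elemSymm_zero, Nat.sub_zero,
        ← sum_elem_mul_cycleTailSum, map_sum]
      simp only [map_smul, map_mul, commImage_elem, hsmul, map_natCast, Nat.cast_zero, zero_sub,
        mul_one, neg_mul, one_mul, neg_zero, Nat.add_sub_add_right]
      rw [← sub_eq_add_neg, sub_eq_zero]
      refine sum_congr rfl fun k _ => ?_
      push_cast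
      ring
  have h2 : coeff (n + 2) ((euler (euler E) - euler E) * G) = commImage K (∑ k ∈ range (n + 2),
        (((k : K) + 1) * k) • (elem K (k + 1) * cycleTailSum K (n + 1 - k))) := by
    have : euler (euler E) - euler E =
        PowerSeries.mk fun k => ((k : MvPowerSeries ℕ K) * (k - 1)) * elemSymm K k := by
      ext1 n
      rw [map_sub, coeff_euler, coeff_euler, hE, elemSymmSeries, coeff_mk, coeff_mk]
      ring
    rw [this, coeff_mk_mul, sum_range_succ', map_sum]
    simp only [map_smul, map_mul, commImage_elem, hsmul, map_natCast, map_add, map_one,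
      Nat.cast_zero, zero_mul, add_zero]
    refine sum_congr rfl fun k _ => ?_
    rw [show n + 2 - (k + 1) = n + 1 - k by omega]
    push_cast
    ring
  have h3 : cycleSeries K = (euler (euler E) - euler E) * G := by
    rw [← cycleSeries_mul]
    linear_combination (cycleSeries K) * h1
  rw [← h2, ← h3, chromaticSymm_cycleGraph, cycleSeries, coeff_succ_X_mul, coeff_mk]

end NSym

/-! ### The theorem -/

open Classical in
theorem mainTheorem6 (K : Type*) [Field K] [CharZero K] (n : ℕ) (hn : 2 ≤ n) :
    ∃ F : NSym K,
      F = (∑ I : Composition n with I.IsCycleIndex,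
            ((2 : K) ^ I.numOnes * (1 - 1 / 2 ^ I.leadingOnes)) • NSym.ribbon K I)
          - NSym.ribbon K (Composition.ones n) ∧
      NSym.IsAnalog F (chromaticSymm K (SimpleGraph.cycleGraph n)) ∧
      NSym.RibbonPositive n F := by
  obtain ⟨n, rfl⟩ := Nat.exists_eq_add_of_le' hn
  refine ⟨_, rfl, ?_, ?_⟩
  · rw [NSym.IsAnalog, NSym.cycle_ribbon_sum_eq, NSym.commImage_cycle]
  · have hblocks : (Composition.ones (n + 2)).blocks = List.replicate (n + 2) 1 :=
      Composition.ones_blocks _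
    have hones : (Composition.ones (n + 2)).IsCycleIndex := by
      rw [Composition.isCycleIndex_iff, hblocks, mem_cycleTails]
      refine ⟨⟨by simp, fun x hx => Or.inl (List.eq_of_mem_replicate hx), ?_⟩, rfl⟩
      rw [List.replicate_succ', List.getLast?_concat]
    refine ⟨fun I => (if I.IsCycleIndex then 2 ^ I.numOnes * (1 - 1 / 2 ^ I.leadingOnes) else 0) -
      if I = Composition.ones (n + 2) then 1 else 0, fun I => ?_, ?_⟩
    · by_cases hI : I = Composition.ones (n + 2)
      · subst hI
        beta_reduce
        rw [if_pos hones, if_pos rfl, Composition.numOnes, Composition.leadingOnes, hblocks,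
          List.takeWhile_replicate]
        simp only [List.count_replicate_self, decide_true, if_true, List.length_replicate]
        -- Only the all-ones composition meets the subtracted ribbon; its total coefficient is
        -- 2^(n+2) - 2.
        rw [mul_sub, mul_one_div_cancel (by positivity), mul_one, pow_add]
        have : (1 : ℚ) ≤ 2 ^ n := one_le_pow₀ (by norm_num)
        linarith
      · beta_reduce
        rw [if_neg hI, sub_zero]
        split_ifs
        · refine mul_nonneg (by positivity) (sub_nonneg.2 ?_)
          rw [div_le_one (by positivity)]
          exact one_le_pow₀ (by norm_num)
        · exact le_rfl
    · push_cast
      simp only [sub_smul, sum_sub_distrib, ite_smul, sum_filter, apply_ite (Rat.cast : ℚ → K)]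
      simp

end
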